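/- Let $A$ be a commutative topological group, written multiplicatively. A character of $A$ is a continuous homomorphism from $A$ into the circle group $\mathbf T$; let $\widehat A$ be the group of characters, with pointwise multiplication. Let $C_b(A)$ be the algebra of bounded continuous functions $A\to\mathbf C$ with the supremum norm. For $f\in C_b(A)$ and $a\in A$ put $f_a(x)=f(xa)$ and $T(f)=\{f_a: a\in A\}$; $f$ is almost periodic if $T(f)$ is totally bounded in $C_b(A)$. The almost periodic functions form a $*$-subalgebra $\mathcal{AP}(A)$ of $C_b(A)$. Then the following hold. (1) A function $f\in C_b(A)$ is almost periodic if and only if, for every $\varepsilon>0$, there are finitely many $c_1,\dots,c_n\in\mathbf C$ and characters $\chi_1,\dots,\chi_n$ of $A$ with $|f(x)-\sum_i c_i\chi_i(x)|<\varepsilon$ for all $x\in A$. In particular every almost periodic function is a uniform limit of finite linear combinations of characters. (2) Let $f$ be almost periodic, let $K$ be the closure of $T(f)$ in $C_b(A)$, and let $\mathcal I(K)$ be the group of isometries of $K$ onto itself with the supremum metric $\rho(R,S)=\sup_{g\in K}\|R(g)-S(g)\|_{\sup}$. Then $K$ is compact and $\mathcal I(K)$ is a compact topological group. Let $\tau\colon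 A\to\mathcal I(K)$ be the homomorphism sending $r$ to the isometry $g\mapsto g_r$, and let $B_f$ be the closure of $\tau(A)$ in $\mathcal I(K)$. Then $B_f$ is a compact commutative group, $\tau\colon A\to B_f$ is continuous with dense image, $\Lambda(R)=(R(f))(e)$ (where $e$ is the identity of $A$) defines a continuous function on $B_f$, and $f(r)=\Lambda(\tau(r))$ for all $r\in A$. (3) Let $\widehat A_d$ be $\widehat A$ with the discrete topology, and let $B=\widehat{(\widehat A_d)}$ be its dual group with the compact-open topology (the Bohr compactification of $A$). Let $h\colon A\to B$ be given by $h(a)(\varphi)=\varphi(a)$. Then $B$ is a compact Hausdorff topological group, and $h$ is a continuous homomorphism with dense image, which is injective if and only if the characters of $A$ separate points of $A$. Moreover $g\mapsto g\circ h$ is an isometric $*$-algebra isomorphism from $C(B)$, with the supremum norm, onto $\mathcal{AP}(A)$. -/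

import Mathlib

open scoped BoundedContinuousFunction

noncomputable section

namespace AlmostPeriodic

section Isometries

variable {X : Type*} [MetricSpace X] [BoundedSpace X]

/-- A surjective isometry of a bounded metric space, as a bounded continuous map. -/
def isometryToBCF (R : X ≃ᵢ X) : X →ᵇ X :=
  BoundedContinuousFunction.mkOfBound ⟨R, R.continuous⟩ (Metric.diam (Set.univ : Set X))
    (fun _ _ => Metric.dist_le_diam_of_mem
      (Bornology.isBounded_univ.2 inferInstance) (Set.mem_univ _) (Set.mem_univ _))

theorem isometryToBCF_injective :
    Function.Injective (isometryToBCF : (X ≃ᵢ X) → (X →ᵇ X)) := by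
  intro R S h
  ext x
  exact DFunLike.congr_fun h x

/-- The group of isometries of a bounded metric space onto itself carries the supremum metric
`dist R S = sup_x dist (R x) (S x)`. -/
instance isometryGroupMetric : MetricSpace (X ≃ᵢ X) :=
  MetricSpace.induced isometryToBCF isometryToBCF_injective inferInstance

theorem isometry_dist_eq_iSup (R S : X ≃ᵢ X) : dist R S = ⨆ x, dist (R x) (S x) :=
  BoundedContinuousFunction.dist_eq_iSup (f := isometryToBCF R) (g := isometryToBCF S)

theorem isometry_dist_le {R S : X ≃ᵢ X} {C : ℝ} (hC : 0 ≤ C) :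
    dist R S ≤ C ↔ ∀ x, dist (R x) (S x) ≤ C :=
  BoundedContinuousFunction.dist_le (f := isometryToBCF R) (g := isometryToBCF S) hC

theorem isometry_dist_apply_le (R S : X ≃ᵢ X) (x : X) : dist (R x) (S x) ≤ dist R S :=
  (isometry_dist_le dist_nonneg).1 le_rfl x

theorem isometry_dist_mul_le (R S R' S' : X ≃ᵢ X) :
    dist (R * S) (R' * S') ≤ dist R R' + dist S S' := by
  refine (isometry_dist_le (by positivity)).2 fun x => ?_
  calc dist (R (S x)) (R' (S' x))
      ≤ dist (R (S x)) (R (S' x)) + dist (R (S' x)) (R' (S' x)) := dist_triangle _ _ _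
    _ = dist (S x) (S' x) + dist (R (S' x)) (R' (S' x)) := by rw [R.dist_eq]
    _ ≤ dist S S' + dist R R' :=
        add_le_add (isometry_dist_apply_le _ _ _) (isometry_dist_apply_le _ _ _)
    _ = dist R R' + dist S S' := add_comm _ _

theorem isometry_dist_inv_le (R S : X ≃ᵢ X) : dist R⁻¹ S⁻¹ ≤ dist R S := by
  refine (isometry_dist_le dist_nonneg).2 fun x => ?_
  have h := isometry_dist_apply_le R S (R⁻¹ x)
  rw [IsometryEquiv.apply_inv_self] at h
  calc dist (R⁻¹ x) (S⁻¹ x) = dist (S (R⁻¹ x)) (S (S⁻¹ x)) := (S.dist_eq _ _).symm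
    _ = dist x (S (R⁻¹ x)) := by rw [IsometryEquiv.apply_inv_self, dist_comm]
    _ ≤ dist R S := h

instance isometryGroup_isTopologicalGroup : IsTopologicalGroup (X ≃ᵢ X) where
  continuous_mul := by
    refine (LipschitzWith.of_dist_le_mul (K := 2) fun p q => ?_).continuous
    refine (isometry_dist_mul_le p.1 p.2 q.1 q.2).trans ?_
    have h1 : dist p.1 q.1 ≤ dist p q := le_max_left _ _
    have h2 : dist p.2 q.2 ≤ dist p q := le_max_right _ _
    push_cast
    linarith
  continuous_inv := by
    refine (LipschitzWith.of_dist_le_mul (K := 1) fun p q => ?_).continuous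
    simpa using isometry_dist_inv_le p q

end Isometries

section Functions

variable {A : Type*} [CommGroup A] [TopologicalSpace A] [IsTopologicalGroup A]

/-- The translate `f_a(x) = f(x a)` of a bounded continuous function. -/
def translate (a : A) (f : A →ᵇ ℂ) : A →ᵇ ℂ :=
  f.compContinuous ⟨fun x => x * a, continuous_mul_const a⟩

@[simp] theorem translate_apply (a : A) (f : A →ᵇ ℂ) (x : A) : translate a f x = f (x * a) := rfl

/-- The set `T(f)` of all translates of `f`. -/
def translates (f : A →ᵇ ℂ) : Set (A →ᵇ ℂ) := Set.range fun a : A => translate a f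

/-- `f` is almost periodic if its set of translates is totally bounded in the supremum norm. -/
def IsAlmostPeriodic (f : A →ᵇ ℂ) : Prop := TotallyBounded (translates f)

theorem translate_one (f : A →ᵇ ℂ) : translate 1 f = f := by ext x; simp

theorem translate_translate (a b : A) (f : A →ᵇ ℂ) :
    translate a (translate b f) = translate (a * b) f := by
  ext x; simp [mul_assoc]

theorem dist_translate (a : A) (f g : A →ᵇ ℂ) :
    dist (translate a f) (translate a g) = dist f g := by
  apply le_antisymm
  · exact (BoundedContinuousFunction.dist_le dist_nonneg).2 fun x =>
      BoundedContinuousFunction.dist_coe_le_dist (x * a)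
  · refine (BoundedContinuousFunction.dist_le dist_nonneg).2 fun x => ?_
    simpa using BoundedContinuousFunction.dist_coe_le_dist
      (f := translate a f) (g := translate a g) (x * a⁻¹)

/-- The closure `K` of the set of translates of `f` in the space of bounded continuous functions. -/
def hull (f : A →ᵇ ℂ) : Set (A →ᵇ ℂ) := closure (translates f)

theorem self_mem_hull (f : A →ᵇ ℂ) : f ∈ hull f := subset_closure ⟨1, translate_one f⟩

instance hull_boundedSpace (f : A →ᵇ ℂ) : BoundedSpace (hull f) := by
  refine boundedSpace_val_set_iff.2 (Bornology.IsBounded.subset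
    (Metric.isBounded_closedBall (x := (0 : A →ᵇ ℂ)) (r := ‖f‖)) ?_)
  refine closure_minimal ?_ Metric.isClosed_closedBall
  rintro _ ⟨a, rfl⟩
  rw [mem_closedBall_zero_iff]
  exact (BoundedContinuousFunction.norm_le (norm_nonneg f)).2 fun x => f.norm_coe_le_norm (x * a)

theorem translate_mem_hull (f : A →ᵇ ℂ) (a : A) {g : A →ᵇ ℂ} (hg : g ∈ hull f) :
    translate a g ∈ hull f := by
  have hc : Continuous (translate a : (A →ᵇ ℂ) → (A →ᵇ ℂ)) :=
    (Isometry.of_dist_eq (dist_translate a)).continuous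
  refine map_mem_closure hc hg ?_
  rintro _ ⟨b, rfl⟩
  exact ⟨a * b, (translate_translate a b f).symm⟩

/-- Translation by `a` as an isometry of the hull of `f` onto itself. -/
def hullTranslation (f : A →ᵇ ℂ) (a : A) : hull f ≃ᵢ hull f where
  toFun g := ⟨translate a g, translate_mem_hull f a g.2⟩
  invFun g := ⟨translate a⁻¹ g, translate_mem_hull f a⁻¹ g.2⟩
  left_inv g := by ext x; simp
  right_inv g := by ext x; simp
  isometry_toFun := Isometry.of_dist_eq fun g g' => dist_translate a g g'

/-- The homomorphism from `A` into the isometry group of the hull given by translations. -/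
def hullHom (f : A →ᵇ ℂ) : A →* (hull f ≃ᵢ hull f) where
  toFun := hullTranslation f
  map_one' := by ext g x; simp [hullTranslation]
  map_mul' a b := by
    ext g x
    change (g : A →ᵇ ℂ) (x * (a * b)) = (g : A →ᵇ ℂ) (x * a * b)
    rw [mul_assoc]

/-- The closure of the image of `A` in the isometry group of the hull of `f`. -/
def hullGroup (f : A →ᵇ ℂ) : Subgroup (hull f ≃ᵢ hull f) := (hullHom f).range.topologicalClosure

/-- The natural homomorphism from `A` into the group `hullGroup f`. -/
def toHullGroup (f : A →ᵇ ℂ) : A →* hullGroup f :=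
  (hullHom f).codRestrict (hullGroup f) fun a =>
    Subgroup.le_topologicalClosure _ ⟨a, rfl⟩

theorem IsAlmostPeriodic.of_continuous_combination {f g k : A →ᵇ ℂ} (hf : IsAlmostPeriodic f)
    (hg : IsAlmostPeriodic g) (F : (A →ᵇ ℂ) → (A →ᵇ ℂ) → (A →ᵇ ℂ))
    (hF : Continuous fun p : (A →ᵇ ℂ) × (A →ᵇ ℂ) => F p.1 p.2)
    (hk : ∀ a, translate a k = F (translate a f) (translate a g)) : IsAlmostPeriodic k := by
  have hf' : IsCompact (closure (translates f)) := hf.closure.isCompact_of_isClosed isClosed_closure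
  have hg' : IsCompact (closure (translates g)) := hg.closure.isCompact_of_isClosed isClosed_closure
  refine ((hf'.prod hg').image hF).totallyBounded.subset ?_
  rintro _ ⟨a, rfl⟩
  exact ⟨(translate a f, translate a g),
    ⟨subset_closure ⟨a, rfl⟩, subset_closure ⟨a, rfl⟩⟩, (hk a).symm⟩

end Functions

section Bohr

variable (A : Type*) [CommGroup A] [TopologicalSpace A] [IsTopologicalGroup A]

/-- The star subalgebra `AP(A)` of almost periodic functions in the bounded continuous functions
on `A`. -/
def AP : StarSubalgebra ℂ (A →ᵇ ℂ) where
  carrier := {f | IsAlmostPeriodic f}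
  mul_mem' hf hg := hf.of_continuous_combination hg (fun u v => u * v) continuous_mul (fun _ => rfl)
  add_mem' hf hg := hf.of_continuous_combination hg (fun u v => u + v) continuous_add (fun _ => rfl)
  algebraMap_mem' c := by
    refine (Set.finite_singleton (algebraMap ℂ (A →ᵇ ℂ) c)).totallyBounded.subset ?_
    rintro _ ⟨a, rfl⟩
    rfl
  star_mem' hf := hf.of_continuous_combination hf (fun u _ => star u)
    (continuous_star.comp continuous_fst) (fun _ => rfl)

/-- The group of characters of `A`, equipped with the discrete topology. -/
def DiscreteDual : Type _ := PontryaginDual A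

instance : CommGroup (DiscreteDual A) := inferInstanceAs (CommGroup (PontryaginDual A))

instance : TopologicalSpace (DiscreteDual A) := ⊥

instance : DiscreteTopology (DiscreteDual A) := ⟨rfl⟩

/-- The Bohr compactification of `A`: the dual of the discrete group of characters of `A`. -/
abbrev BohrCompactification : Type _ := PontryaginDual (DiscreteDual A)

variable {A}

/-- The evaluation `φ ↦ φ a` at a point `a`, as a character of the discrete dual. -/
def evalCharacter (a : A) : BohrCompactification A :=
  ({ toFun := fun φ => (show PontryaginDual A from φ) a
     map_one' := rfl
     map_mul' := fun _ _ => rfl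
     continuous_toFun := continuous_of_discreteTopology } : DiscreteDual A →ₜ* Circle)

variable (A)

/-- The canonical homomorphism `a ↦ (φ ↦ φ a)` from `A` into its Bohr compactification. -/
def bohrHom : A →* BohrCompactification A where
  toFun := evalCharacter
  map_one' := PontryaginDual.ext fun φ => map_one (show PontryaginDual A from φ)
  map_mul' a b := PontryaginDual.ext fun φ => map_mul (show PontryaginDual A from φ) a b

end Bohr

end AlmostPeriodic

end

open AlmostPeriodic

/-!
The theorem rests on the fact that the characters of a compact Hausdorff commutative group `G`
separate its points (`exists_character_ne_one`). For a strongly continuous unitary representation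
`U` of `G` on a Hilbert space and a vector `k ≠ 0`, the average `∫ ⟪U x k, ·⟫ U x k dx` is a nonzero
compact self-adjoint operator commuting with `U`. Any of its eigenspaces for a nonzero eigenvalue is
finite-dimensional and invariant, so it contains a joint eigenvector of `U`, whose eigenvalues form
a character; and this eigenvector is not orthogonal to `k`. If all characters were trivial at `a`,
then `a` would fix every joint eigenvector, hence every vector, of the regular representation on
`L²(G)`, which forces `a = 1`. By Stone–Weierstrass the trigonometric polynomials are dense in
`C(G)` (`dense_span_range_characterCM`).

For an almost periodic `f` the hull is compact, so its isometry group is compact by Arzelà–Ascoli.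
On the compact hull the uniform topology is that of pointwise convergence, so `a ↦ f_a` is
continuous in norm, and with it `A → B_f`. Thus `f` factors through the compact
commutative group `B_f` and is a uniform limit of trigonometric polynomials. The converse holds
because characters are almost periodic and the almost periodic functions form a closed subalgebra.

For the Bohr compactification `B`, density of the image of `A` (`denseRange_bohrHom`) needs no
duality theorem. The evaluations at characters of `A` span a dense subspace of `C(B)`, and both the
Haar probability measure of `B` and that of the closure of the image of `A` annihilate the
evaluations at nontrivial characters. So the two measures have the same integrals, and as Haar
measure of `B` charges nonempty open sets the closure is all of `B`. Composition with `A → B` is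
then isometric on `C(B)`, and its closed range contains the characters, hence `AP(A)`.
-/

namespace AlmostPeriodic

open MeasureTheory Module.End InnerProductSpace

/-! ### Joint eigenvectors of unitary representations of compact commutative groups -/

section PeterWeyl

/-- A commuting family of endomorphisms that leaves a nonzero finite-dimensional complex subspace
invariant has a joint eigenvector in it: on an invariant nonzero subspace of minimal dimension every
member of the family is a scalar. -/
theorem exists_joint_eigenvector {ι V : Type*} [AddCommGroup V] [Module ℂ V]
    (U : ι → Module.End ℂ V) (hU : ∀ i j, Commute (U i) (U j))
    (E : Submodule ℂ V) [FiniteDimensional ℂ E] (hE : E ≠ ⊥) (hinv : ∀ i, ∀ v ∈ E, U i v ∈ E) :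
    ∃ v ∈ E, v ≠ 0 ∧ ∀ i, ∃ c : ℂ, U i v = c • v := by
  let P : ℕ → Prop := fun n => ∃ F : Submodule ℂ V, F ≤ E ∧ F ≠ ⊥ ∧ (∀ i, ∀ v ∈ F, U i v ∈ F) ∧
    Module.finrank ℂ F = n
  have hP : ∃ n, P n := ⟨_, E, le_rfl, hE, hinv, rfl⟩
  classical
  obtain ⟨F, hFE, hF, hFinv, hFn⟩ := Nat.find_spec hP
  have hfin : FiniteDimensional ℂ F := Submodule.finiteDimensional_of_le hFE
  obtain ⟨v, hvF, hv⟩ := Submodule.exists_mem_ne_zero_of_ne_bot hF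
  refine ⟨v, hFE hvF, hv, fun i => ?_⟩
  have : Nontrivial F := Submodule.nontrivial_iff_ne_bot.2 hF
  obtain ⟨c, hc⟩ := Module.End.exists_eigenvalue ((U i).restrict (hFinv i))
  obtain ⟨w, hw⟩ := hc.exists_hasEigenvector
  have hwU : U i (w : V) = c • (w : V) := congrArg Subtype.val hw.apply_eq_smul
  let F' := F ⊓ eigenspace (U i) c
  have hF' : F' ≠ ⊥ := by
    refine (Submodule.ne_bot_iff _).2 ⟨w, ⟨w.2, mem_eigenspace_iff.2 hwU⟩, ?_⟩
    simpa using hw.2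
  have hF'inv : ∀ j, ∀ u ∈ F', U j u ∈ F' := by
    intro j u hu
    refine ⟨hFinv j u hu.1, mem_eigenspace_iff.2 ?_⟩
    have h1 : U i (U j u) = U j (U i u) := LinearMap.congr_fun (hU i j).eq u
    rw [h1, mem_eigenspace_iff.1 hu.2, map_smul]
  have hle : Module.finrank ℂ F ≤ Module.finrank ℂ F' := by
    rw [hFn]
    exact Nat.find_min' hP ⟨F', inf_le_left.trans hFE, hF', hF'inv, rfl⟩
  have heq : F' = F := Submodule.eq_of_le_of_finrank_le inf_le_left hle
  exact ⟨c, mem_eigenspace_iff.1 (heq ▸ hvF : v ∈ F').2⟩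

variable {G : Type*} [CommGroup G] [TopologicalSpace G]
variable {H : Type*} [NormedAddCommGroup H] [InnerProductSpace ℂ H]

/-- The scalars by which a strongly continuous unitary representation acts on a joint eigenvector
form a character. -/
theorem exists_character_of_joint_eigenvector (U : G →* (H →ₗᵢ[ℂ] H))
    (hU : ∀ v, Continuous fun x => U x v) {v : H} (hv : v ≠ 0)
    (h : ∀ x, ∃ c : ℂ, U x v = c • v) :
    ∃ χ : PontryaginDual G, ∀ x, U x v = (χ x : ℂ) • v := by
  choose c hc using h
  have hv' : ‖v‖ ≠ 0 := norm_ne_zero_iff.2 hv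
  have hnorm : ∀ x, ‖c x‖ = 1 := by
    intro x
    have h1 : ‖U x v‖ = ‖v‖ := (U x).norm_map v
    rw [hc x, norm_smul] at h1
    exact (mul_eq_right₀ hv').1 h1
  have hone : c 1 = 1 := by
    have h1 := hc 1
    rw [map_one] at h1
    exact smul_left_injective ℂ hv (by simpa using h1.symm)
  have hmul : ∀ x y, c (x * y) = c x * c y := by
    intro x y
    have h1 : U (x * y) v = U x (U y v) := by rw [map_mul]; rfl
    rw [hc, hc y, map_smul, hc x, smul_smul] at h1
    rw [smul_left_injective ℂ hv h1, mul_comm]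
  have hcont : Continuous c := by
    have h1 : c = fun x => inner ℂ v (U x v) / inner ℂ v v := by
      funext x
      rw [hc x, inner_smul_right, mul_div_cancel_right₀ _ (inner_self_ne_zero.2 hv)]
    rw [h1]
    exact (continuous_const.inner (hU v)).div_const _
  let χ : G →ₜ* Circle :=
    { toFun := fun x => ⟨c x, mem_sphere_zero_iff_norm.2 (hnorm x)⟩
      map_one' := Subtype.ext hone
      map_mul' := fun x y => Subtype.ext (hmul x y)
      continuous_toFun := hcont.subtype_mk _ }
  exact ⟨χ, hc⟩

theorem integrable_of_continuous {X E : Type*} [TopologicalSpace X] [CompactSpace X]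
    [MeasurableSpace X] [BorelSpace X] (μ : Measure X) [IsFiniteMeasure μ]
    [NormedAddCommGroup E] {f : X → E} (hf : Continuous f) : Integrable f μ :=
  hf.integrable_of_hasCompactSupport (HasCompactSupport.of_compactSpace f)

/-- The average of the rank-one operators `⟪U x k, ·⟫ U x k` over the group. -/
noncomputable def averagedRankOne [MeasurableSpace G] (μ : Measure G) (U : G →* (H →ₗᵢ[ℂ] H))
    (k : H) : H →L[ℂ] H :=
  ∫ x, rankOne ℂ (U x k) (U x k) ∂μ

theorem continuous_rankOne_orbit (U : G →* (H →ₗᵢ[ℂ] H)) (hU : ∀ v, Continuous fun x => U x v)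
    (k : H) : Continuous fun x => rankOne ℂ (U x k) (U x k) :=
  ((isBoundedBilinearMap_smulRight (𝕜 := ℂ) (E := H) (F := H)).continuous.comp
    (((innerSL ℂ).continuous.comp (hU k)).prodMk (hU k)) :)

section Average

variable [CompactSpace G] [MeasurableSpace G] [BorelSpace G]
  (μ : Measure G) [IsFiniteMeasure μ] (U : G →* (H →ₗᵢ[ℂ] H))

theorem averagedRankOne_apply (hU : ∀ v, Continuous fun x => U x v) (k : H) (v : H) :
    averagedRankOne μ U k v = ∫ x, inner ℂ (U x k) v • U x k ∂μ := by
  rw [averagedRankOne, ContinuousLinearMap.integral_apply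
    (integrable_of_continuous μ (continuous_rankOne_orbit U hU k))]
  rfl

theorem inner_averagedRankOne_apply [CompleteSpace H]
    (hU : ∀ v, Continuous fun x => U x v) (k : H) (u v : H) :
    inner ℂ u (averagedRankOne μ U k v) = ∫ x, inner ℂ (U x k) v * inner ℂ u (U x k) ∂μ := by
  rw [averagedRankOne_apply μ U hU, ← integral_inner]
  · simp_rw [inner_smul_right]
  · exact integrable_of_continuous μ (((hU k).inner continuous_const).smul (hU k))

theorem isSymmetric_averagedRankOne [CompleteSpace H]
    (hU : ∀ v, Continuous fun x => U x v) (k : H) : (averagedRankOne μ U k).IsSymmetric := by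
  intro u v
  change inner ℂ (averagedRankOne μ U k u) v = inner ℂ u (averagedRankOne μ U k v)
  rw [← inner_conj_symm, inner_averagedRankOne_apply μ U hU, inner_averagedRankOne_apply μ U hU,
    ← integral_conj]
  congr 1 with x
  simp [mul_comm]

/-- Compactness: compact operators form a closed subspace, which contains the integral of every
continuous function with values in it. -/
theorem isCompactOperator_averagedRankOne [CompleteSpace H]
    (hU : ∀ v, Continuous fun x => U x v) (k : H) :
    IsCompactOperator (averagedRankOne μ U k) := by
  let K : Submodule ℂ (H →L[ℂ] H) := compactOperator (RingHom.id ℂ) H H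
  have hK : IsClosed (K : Set (H →L[ℂ] H)) := isClosed_setOfPred_isCompactOperator
  have hmem : ∀ x, rankOne ℂ (U x k) (U x k) ∈ K := by
    intro x
    change IsCompactOperator _
    exact (isCompactOperator_of_locallyCompactSpace_rng
      (ContinuousLinearMap.toSpanSingleton ℂ (U x k))).comp_clm (innerSL ℂ (U x k))
  have : CompleteSpace K := hK.completeSpace_coe
  let F : G → K := fun x => ⟨_, hmem x⟩
  have hF : Integrable F μ :=
    integrable_of_continuous μ ((continuous_rankOne_orbit U hU k).subtype_mk _)
  have h : averagedRankOne μ U k = ((∫ x, F x ∂μ : K) : H →L[ℂ] H) :=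
    K.subtypeL.integral_comp_comm hF
  rw [h]
  exact (∫ x, F x ∂μ : K).2

theorem averagedRankOne_commute [IsTopologicalGroup G] [CompleteSpace H] [μ.IsMulLeftInvariant]
    (hU : ∀ v, Continuous fun x => U x v) (k : H) (y : G) (v : H) :
    averagedRankOne μ U k (U y v) = U y (averagedRankOne μ U k v) := by
  rw [averagedRankOne_apply μ U hU, averagedRankOne_apply μ U hU,
    ← integral_mul_left_eq_self _ y]
  have h := (U y).toContinuousLinearMap.integral_comp_comm (μ := μ)
    (integrable_of_continuous μ
      (((hU k).inner (𝕜 := ℂ) (continuous_const (y := v))).smul (hU k)))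
  refine Eq.trans ?_ h
  congr 1 with x
  have h1 : U (y * x) k = U y (U x k) := by rw [map_mul]; rfl
  rw [h1, (U y).inner_map_map]
  exact ((U y).map_smul _ _).symm

theorem averagedRankOne_ne_zero [CompleteSpace H] [μ.IsOpenPosMeasure]
    (hU : ∀ v, Continuous fun x => U x v) (k : H) (hk : k ≠ 0) :
    averagedRankOne μ U k ≠ 0 := by
  intro h0
  have h1 := inner_averagedRankOne_apply μ U hU k k k
  rw [h0] at h1
  have h2 : ∀ x, inner ℂ (U x k) k * inner ℂ k (U x k) = ((‖inner ℂ k (U x k)‖ ^ 2 : ℝ) : ℂ) := by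
    intro x
    rw [← inner_conj_symm, ← Complex.normSq_eq_conj_mul_self, Complex.normSq_eq_norm_sq]
  simp_rw [h2] at h1
  rw [integral_complex_ofReal] at h1
  have h3 : 0 < ∫ x, ‖inner ℂ k (U x k)‖ ^ 2 ∂μ := by
    have hc : Continuous fun x => ‖inner ℂ k (U x k)‖ ^ 2 :=
      (continuous_const.inner (hU k)).norm.pow 2
    refine hc.integral_pos_of_hasCompactSupport_nonneg_nonzero
      (HasCompactSupport.of_compactSpace _) (fun x => by positivity) (x := 1) ?_
    simpa using hk
  rw [zero_apply, inner_zero_right] at h1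
  exact h3.ne (by exact_mod_cast h1)

end Average

/-- In a strongly continuous unitary representation of a compact commutative group, no nonzero
vector is orthogonal to all joint eigenvectors. -/
theorem exists_character_inner_ne_zero [IsTopologicalGroup G] [CompactSpace G] [CompleteSpace H]
    (U : G →* (H →ₗᵢ[ℂ] H))
    (hU : ∀ v, Continuous fun x => U x v) {k : H} (hk : k ≠ 0) :
    ∃ (χ : PontryaginDual G) (v : H), (∀ x, U x v = (χ x : ℂ) • v) ∧ inner ℂ k v ≠ 0 := by
  borelize G
  let μ : Measure G := Measure.haarMeasure ⊤
  let T := averagedRankOne μ U k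
  have hT : IsCompactOperator T := isCompactOperator_averagedRankOne μ U hU k
  have hTs : T.IsSymmetric := isSymmetric_averagedRankOne μ U hU k
  have hT0 : T ≠ 0 := averagedRankOne_ne_zero μ U hU k hk
  rw [Ne, ← ContinuousLinearMap.eq_zero_of_forall_hasEigenvalue_eq_zero hT hTs] at hT0
  push Not at hT0
  obtain ⟨c, hc, hc0⟩ := hT0
  have hfin := ContinuousLinearMap.finite_dimensional_eigenspace hT c hc0
  obtain ⟨v, hvE, hv0, hv⟩ := exists_joint_eigenvector (fun x => ((U x).toLinearMap : H →ₗ[ℂ] H))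
    (fun x y => LinearMap.ext fun v => by
      change (U x * U y) v = (U y * U x) v
      rw [← map_mul, ← map_mul, mul_comm])
    (eigenspace (T : Module.End ℂ H) c) hc (fun x v hv => by
      rw [mem_eigenspace_iff] at hv ⊢
      change T v = c • v at hv
      change T (U x v) = c • U x v
      rw [averagedRankOne_commute μ U hU k, hv, map_smul])
  obtain ⟨χ, hχ⟩ := exists_character_of_joint_eigenvector U hU hv0 hv
  refine ⟨χ, v, hχ, fun hkv => ?_⟩
  -- A joint eigenvector orthogonal to `k` is orthogonal to the whole orbit of `k`, so the
  -- averaged operator kills it.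
  have horb : ∀ x, inner ℂ (U x k) v = 0 := by
    intro x
    have h1 := (U x).inner_map_map k v
    rw [hkv, hχ, inner_smul_right] at h1
    exact (mul_eq_zero.1 h1).resolve_left (χ x).coe_ne_zero
  have hTv : T v = 0 := by
    rw [averagedRankOne_apply μ U hU]
    simp [horb]
  have hvE' : T v = c • v := mem_eigenspace_iff.1 hvE
  rw [hTv] at hvE'
  exact (smul_ne_zero hc0 hv0) hvE'.symm

/-- The regular representation `(U a u)(x) = u(a x)` of a commutative group on `L²`. The action of
`DomMulAct G` reverses products, which is harmless as `G` is commutative. -/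
noncomputable def regularRepresentation [IsTopologicalGroup G] [MeasurableSpace G] [BorelSpace G]
    (μ : Measure G) [μ.IsMulLeftInvariant] : G →* (Lp ℂ 2 μ →ₗᵢ[ℂ] Lp ℂ 2 μ) where
  toFun a :=
    { toFun := fun u => DomMulAct.mk a • u
      map_add' := fun u v => smul_add _ u v
      map_smul' := fun c u => smul_comm _ c u
      norm_map' := fun u => DomMulAct.norm_smul_Lp _ u }
  map_one' := LinearIsometry.ext fun u => one_smul _ u
  map_mul' a b := LinearIsometry.ext fun u => by
    change DomMulAct.mk (a * b) • u = DomMulAct.mk a • DomMulAct.mk b • u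
    rw [smul_smul, ← DomMulAct.mk_mul, mul_comm]

/-- The characters of a compact Hausdorff commutative group separate its points. -/
theorem exists_character_ne_one [IsTopologicalGroup G] [CompactSpace G] [T2Space G] {a : G}
    (ha : a ≠ 1) :
    ∃ χ : PontryaginDual G, χ a ≠ 1 := by
  borelize G
  let μ : Measure G := Measure.haarMeasure ⊤
  let U := regularRepresentation μ
  have : Fact ((2 : ENNReal) ≠ ⊤) := ⟨ENNReal.ofNat_ne_top⟩
  have hU : ∀ u, Continuous fun x => U x u := fun u =>
    (DomMulAct.continuous_mk.smul (continuous_const (y := u)) :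
      Continuous fun x : G => DomMulAct.mk x • u)
  by_contra! htriv
  -- Otherwise `a` fixes all joint eigenvectors, hence acts trivially on `L²`.
  have hfix : ∀ u : Lp ℂ 2 μ, U a u = u := by
    intro u
    by_contra hu
    obtain ⟨χ, v, hχ, hv⟩ := exists_character_inner_ne_zero U hU (sub_ne_zero.2 hu)
    refine hv ?_
    have h1 : U a v = v := by rw [hχ, htriv]; simp
    rw [inner_sub_left, sub_eq_zero, ← (U a).inner_map_map u v, h1]
  obtain ⟨g, hg1, hga, -⟩ := exists_continuous_zero_one_of_isClosed
    (isClosed_singleton (x := (1 : G))) (isClosed_singleton (x := a)) (by simpa using ha.symm)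
  have hg : MemLp (fun x => (g x : ℂ)) 2 μ :=
    (Complex.continuous_ofReal.comp g.continuous).memLp_of_hasCompactSupport
      (HasCompactSupport.of_compactSpace _)
  have h1 := hfix hg.toLp
  change DomMulAct.mk a • hg.toLp = hg.toLp at h1
  rw [DomMulAct.mk_smul_toLp, MemLp.toLp_eq_toLp_iff] at h1
  have h2 := Measure.eq_of_ae_eq h1 (by fun_prop) (by fun_prop)
  have h3 := congrFun h2 1
  simp only [smul_eq_mul, mul_one] at h3
  rw [hg1 rfl, hga rfl] at h3
  simp at h3

end PeterWeyl

/-! ### Trigonometric polynomials -/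

section CharacterSpan

variable {G : Type*} [CommGroup G] [TopologicalSpace G]

/-- A character, as a bounded continuous function. -/
noncomputable def characterBCF (χ : PontryaginDual G) : G →ᵇ ℂ :=
  BoundedContinuousFunction.ofNormedAddCommGroup (fun x => (χ x : ℂ))
    (continuous_subtype_val.comp (map_continuous χ)) 1 fun x => (Circle.norm_coe (χ x)).le

/-- A character, as an element of the algebra of continuous functions. -/
noncomputable def characterCM (χ : PontryaginDual G) : C(G, ℂ) :=
  ⟨fun x => (χ x : ℂ), continuous_subtype_val.comp (map_continuous χ)⟩

/-- The space of trigonometric polynomials: finite linear combinations of characters. -/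
noncomputable def trigPolynomials (G : Type*) [CommGroup G] [TopologicalSpace G] :
    Submodule ℂ (G →ᵇ ℂ) :=
  Submodule.span ℂ (Set.range characterBCF)

theorem mem_closure_trigPolynomials_iff {f : G →ᵇ ℂ} :
    f ∈ closure (trigPolynomials G : Set (G →ᵇ ℂ)) ↔
      ∀ ε : ℝ, 0 < ε → ∃ (n : ℕ) (c : Fin n → ℂ) (χ : Fin n → PontryaginDual G),
        ∀ x : G, ‖f x - ∑ i, c i * (χ i x : ℂ)‖ < ε := by
  rw [Metric.mem_closure_iff]
  have key : ∀ (n : ℕ) (c : Fin n → ℂ) (χ : Fin n → PontryaginDual G) (x : G),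
      ‖f x - ∑ i, c i * (χ i x : ℂ)‖ = dist (f x) ((∑ i, c i • characterBCF (χ i) : G →ᵇ ℂ) x) := by
    intro n c χ x
    rw [dist_eq_norm, BoundedContinuousFunction.sum_apply]
    rfl
  constructor
  · intro h ε hε
    obtain ⟨g, hg, hfg⟩ := h ε hε
    obtain ⟨n, c, χ, rfl⟩ := Submodule.mem_span_set'.1 hg
    choose ψ hψ using fun i => (χ i).2
    refine ⟨n, c, ψ, fun x => ?_⟩
    rw [key]
    simp_rw [hψ]
    exact (BoundedContinuousFunction.dist_coe_le_dist x).trans_lt hfg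
  · intro h ε hε
    obtain ⟨n, c, χ, hχ⟩ := h (ε / 2) (half_pos hε)
    refine ⟨∑ i, c i • characterBCF (χ i), Submodule.sum_mem _ fun i _ =>
      Submodule.smul_mem _ _ (Submodule.subset_span ⟨_, rfl⟩), ?_⟩
    refine lt_of_le_of_lt ?_ (half_lt_self hε)
    refine (BoundedContinuousFunction.dist_le (half_pos hε).le).2 fun x => ?_
    rw [← key]
    exact (hχ x).le

/-- Stone–Weierstrass: the span of a group of characters separating the points of a compact space
is a star subalgebra, and it is dense. -/
theorem dense_span_characterCM [CompactSpace G] {D : Type*} [Group D]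
    (e : D →* PontryaginDual G) (he : ∀ x y : G, x ≠ y → ∃ d, e d x ≠ e d y) :
    Dense (Submodule.span ℂ (Set.range fun d => characterCM (e d)) : Set C(G, ℂ)) := by
  let S : Set C(G, ℂ) := Set.range fun d => characterCM (e d)
  have hstar : star S ⊆ S := by
    rintro g ⟨d, hd⟩
    refine ⟨d⁻¹, ContinuousMap.ext fun x => ?_⟩
    have h1 : characterCM (e d) x = star (g x) := DFunLike.congr_fun hd x
    have h2 : g x = star (characterCM (e d) x) := by rw [h1, star_star]
    change (e d⁻¹ x : ℂ) = _
    rw [h2, map_inv]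
    exact Circle.coe_inv_eq_conj _
  let M : Submonoid C(G, ℂ) :=
    { carrier := S
      one_mem' := ⟨1, ContinuousMap.ext fun x => by
        change (e 1 x : ℂ) = 1
        rw [map_one]; exact Circle.coe_one⟩
      mul_mem' := by
        rintro _ _ ⟨d, rfl⟩ ⟨d', rfl⟩
        exact ⟨d * d', ContinuousMap.ext fun x => by
          change (e (d * d') x : ℂ) = e d x * e d' x
          rw [map_mul]; exact Circle.coe_mul _ _⟩ }
  have hadj : Subalgebra.toSubmodule (StarAlgebra.adjoin ℂ S).toSubalgebra =
      Submodule.span ℂ S := by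
    rw [StarAlgebra.adjoin_toSubalgebra, Set.union_eq_self_of_subset_right hstar,
      Algebra.adjoin_eq_span, show Submonoid.closure S = M from M.closure_eq]
    rfl
  have hsep : (StarAlgebra.adjoin ℂ S).toSubalgebra.SeparatesPoints := by
    intro x y hxy
    obtain ⟨d, hd⟩ := he x y hxy
    exact ⟨_, ⟨_, StarAlgebra.subset_adjoin ℂ S ⟨d, rfl⟩, rfl⟩,
      fun h => hd (Circle.coe_injective h)⟩
  have htop := ContinuousMap.starSubalgebra_topologicalClosure_eq_top_of_separatesPoints _ hsep
  have hset : (Submodule.span ℂ S : Set C(G, ℂ)) = (StarAlgebra.adjoin ℂ S : Set C(G, ℂ)) := by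
    rw [← hadj]; rfl
  change Dense (Submodule.span ℂ S : Set C(G, ℂ))
  rw [hset, dense_iff_closure_eq, ← StarSubalgebra.topologicalClosure_coe, htop]
  rfl

theorem dense_span_range_characterCM [IsTopologicalGroup G] [CompactSpace G] [T2Space G] :
    Dense (Submodule.span ℂ (Set.range (characterCM (G := G))) : Set C(G, ℂ)) := by
  refine dense_span_characterCM (MonoidHom.id _) fun x y hxy => ?_
  obtain ⟨χ, hχ⟩ := exists_character_ne_one (a := x / y) (by rwa [Ne, div_eq_one])
  refine ⟨χ, fun h => hχ ?_⟩
  rw [map_div, div_eq_one]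
  exact h

/-- Composition of continuous functions on a compact space `Y` with a continuous map into `Y`. -/
noncomputable def pullback {X Y : Type*} [TopologicalSpace X] [TopologicalSpace Y] [CompactSpace Y]
    (h : C(X, Y)) : C(Y, ℂ) →⋆ₐ[ℂ] (X →ᵇ ℂ) where
  toFun g := (BoundedContinuousFunction.mkOfCompact g).compContinuous h
  map_one' := rfl
  map_mul' _ _ := rfl
  map_zero' := rfl
  map_add' _ _ := rfl
  commutes' _ := rfl
  map_star' _ := rfl

theorem continuous_pullback {X Y : Type*} [TopologicalSpace X] [TopologicalSpace Y]
    [CompactSpace Y] (h : C(X, Y)) : Continuous (pullback h) :=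
  (BoundedContinuousFunction.continuous_compContinuous h).comp
    (ContinuousMap.isometryEquivBoundedOfCompact Y ℂ).continuous

/-- A function that factors continuously through a compact Hausdorff commutative group is a uniform
limit of trigonometric polynomials. -/
theorem pullback_mem_closure_trigPolynomials {K : Type*} [CommGroup K] [TopologicalSpace K]
    [IsTopologicalGroup K] [CompactSpace K] [T2Space K] (h : G →ₜ* K) (g : C(K, ℂ)) :
    pullback (h : C(G, K)) g ∈ closure (trigPolynomials G : Set (G →ᵇ ℂ)) := by
  refine map_mem_closure (continuous_pullback _) (dense_span_range_characterCM g) fun k hk => ?_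
  have hle : Submodule.span ℂ (Set.range (characterCM (G := K))) ≤
      (trigPolynomials G).comap (pullback (h : C(G, K))).toAlgHom.toLinearMap := by
    rw [Submodule.span_le]
    rintro _ ⟨χ, rfl⟩
    exact Submodule.subset_span ⟨PontryaginDual.map h χ, rfl⟩
  exact hle hk

end CharacterSpan

/-! ### The isometry group of a compact metric space -/

section Isometries

variable {X : Type*} [MetricSpace X] [CompactSpace X]

/-- A uniform limit `F` of surjective isometries `R` is again one. It is surjective since
`F (R⁻¹ y)` is close to `y` and the range of `F` is compact. -/
theorem isClosed_range_isometryToBCF : IsClosed (Set.range (isometryToBCF (X := X))) := by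
  refine isClosed_of_closure_subset fun F hF => ?_
  have hiso : Isometry F := by
    have hcl : IsClosed {F : X →ᵇ X | ∀ x y, dist (F x) (F y) = dist x y} := by
      simp only [Set.ofPred_forall]
      refine isClosed_iInter fun x => isClosed_iInter fun y => isClosed_eq ?_ continuous_const
      exact (continuous_eval_const x).dist
        (continuous_eval_const y)
    refine Isometry.of_dist_eq (closure_minimal ?_ hcl hF)
    rintro _ ⟨R, rfl⟩ x y
    exact R.dist_eq x y
  have hsurj : Function.Surjective F := by
    intro y
    have hcl : IsClosed (Set.range F) := (isCompact_range F.continuous).isClosed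
    change y ∈ Set.range F
    rw [← hcl.closure_eq, Metric.mem_closure_range_iff]
    intro ε hε
    obtain ⟨_, ⟨R, rfl⟩, hR⟩ := Metric.mem_closure_iff.1 hF ε hε
    refine ⟨R.symm y, ?_⟩
    have h1 := BoundedContinuousFunction.dist_coe_le_dist (f := F) (g := isometryToBCF R) (R.symm y)
    have h2 : isometryToBCF R (R.symm y) = y := R.apply_symm_apply y
    rw [h2, dist_comm] at h1
    exact h1.trans_lt hR
  exact ⟨⟨Equiv.ofBijective F ⟨hiso.injective, hsurj⟩, hiso⟩, by ext x; rfl⟩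

/-- Arzelà–Ascoli: the isometry group of a compact metric space is compact. -/
instance compactSpace_isometryEquiv : CompactSpace (X ≃ᵢ X) := by
  have hind : Topology.IsInducing (isometryToBCF : (X ≃ᵢ X) → (X →ᵇ X)) := ⟨rfl⟩
  rw [← isCompact_univ_iff, hind.isCompact_iff, Set.image_univ]
  refine BoundedContinuousFunction.arzela_ascoli₁ _ isClosed_range_isometryToBCF ?_
  refine (LipschitzWith.uniformEquicontinuous _ 1 ?_).equicontinuous
  rintro ⟨_, R, rfl⟩
  exact R.isometry.lipschitz

end Isometries

/-! ### The hull of an almost periodic function -/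

section Hull

variable {A : Type*} [CommGroup A] [TopologicalSpace A] [IsTopologicalGroup A] {f : A →ᵇ ℂ}

theorem IsAlmostPeriodic.isCompact_hull (hf : IsAlmostPeriodic f) : IsCompact (hull f) :=
  hf.closure.isCompact_of_isClosed isClosed_closure

/-- On the compact hull, the uniform topology is the topology of pointwise convergence, for which
`a ↦ f_a` is obviously continuous. -/
theorem IsAlmostPeriodic.continuous_translate (hf : IsAlmostPeriodic f) :
    Continuous fun a => translate a f := by
  have : CompactSpace (hull f) := isCompact_iff_compactSpace.1 hf.isCompact_hull
  let ev : hull f → (A → ℂ) := fun g => (g : A →ᵇ ℂ)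
  have hev : Continuous ev := BoundedContinuousFunction.continuous_coe.comp continuous_subtype_val
  have hinj : Function.Injective ev := fun g g' h => Subtype.ext (DFunLike.coe_injective h)
  have hemb := hev.isClosedEmbedding hinj
  let orbit : A → hull f := fun a => ⟨translate a f, subset_closure ⟨a, rfl⟩⟩
  have horb : Continuous orbit := by
    rw [hemb.isInducing.continuous_iff]
    refine continuous_pi fun x => ?_
    exact f.continuous.comp (continuous_const.mul continuous_id)
  exact continuous_subtype_val.comp horb

theorem translate_comm (a b : A) (g : A →ᵇ ℂ) :
    translate a (translate b g) = translate b (translate a g) := by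
  rw [translate_translate, translate_translate, mul_comm]

/-- Since `A` is commutative, the displacement of `f` under two translations bounds that of every
element of its hull. -/
theorem dist_hullHom_le (a b : A) :
    dist (hullHom f a) (hullHom f b) ≤ dist (translate a f) (translate b f) := by
  refine (isometry_dist_le dist_nonneg).2 fun g => ?_
  change dist (translate a (g : A →ᵇ ℂ)) (translate b (g : A →ᵇ ℂ)) ≤ _
  have hcl : IsClosed {g : A →ᵇ ℂ | dist (translate a g) (translate b g) ≤
      dist (translate a f) (translate b f)} :=
    isClosed_le ((Isometry.of_dist_eq (dist_translate a)).continuous.dist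
      (Isometry.of_dist_eq (dist_translate b)).continuous) continuous_const
  refine closure_minimal ?_ hcl g.2
  rintro _ ⟨c, rfl⟩
  change dist (translate a (translate c f)) (translate b (translate c f)) ≤ _
  rw [translate_comm a c, translate_comm b c, dist_translate]

theorem IsAlmostPeriodic.continuous_hullHom (hf : IsAlmostPeriodic f) :
    Continuous (hullHom f) := by
  refine continuous_iff_continuousAt.2 fun b => tendsto_iff_dist_tendsto_zero.2 ?_
  refine squeeze_zero (fun _ => dist_nonneg) (fun a => dist_hullHom_le a b) ?_
  exact tendsto_iff_dist_tendsto_zero.1 (hf.continuous_translate.tendsto b)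

theorem IsAlmostPeriodic.continuous_toHullGroup (hf : IsAlmostPeriodic f) :
    Continuous (toHullGroup f) :=
  hf.continuous_hullHom.subtype_mk _

theorem denseRange_toHullGroup (f : A →ᵇ ℂ) : DenseRange (toHullGroup f) := by
  intro R
  rw [closure_subtype]
  have hR : (R : hull f ≃ᵢ hull f) ∈ closure (Set.range (hullHom f)) := R.2
  convert hR using 2
  rw [← Set.range_comp]
  rfl

theorem hullGroup_mul_comm (f : A →ᵇ ℂ) (R S : hullGroup f) : R * S = S * R :=
  (Subgroup.commGroupTopologicalClosure (hullHom f).range fun x y => mul_comm' x y).mul_comm R S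

noncomputable instance hullGroupCommGroup (f : A →ᵇ ℂ) : CommGroup (hullGroup f) :=
  { (inferInstance : Group (hullGroup f)) with mul_comm := hullGroup_mul_comm f }

theorem IsAlmostPeriodic.compactSpace_hullGroup (hf : IsAlmostPeriodic f) :
    CompactSpace (hullGroup f) := by
  have : CompactSpace (hull f) := isCompact_iff_compactSpace.1 hf.isCompact_hull
  exact isCompact_iff_compactSpace.1 (Subgroup.isClosed_topologicalClosure _).isCompact

/-- Evaluation at the identity of the image of `f` under an isometry of its hull. -/
noncomputable def hullEval (f : A →ᵇ ℂ) : C(hullGroup f, ℂ) where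
  toFun R := ((R : hull f ≃ᵢ hull f) ⟨f, self_mem_hull f⟩ : A →ᵇ ℂ) 1
  continuous_toFun := by
    refine (continuous_eval_const 1).comp
      (continuous_subtype_val.comp ?_)
    have h : Continuous fun R : hull f ≃ᵢ hull f => R ⟨f, self_mem_hull f⟩ :=
      (LipschitzWith.of_dist_le_mul (K := 1) fun R S => by
        simpa using isometry_dist_apply_le R S ⟨f, self_mem_hull f⟩).continuous
    exact h.comp continuous_subtype_val

theorem hullEval_toHullGroup (f : A →ᵇ ℂ) (r : A) : hullEval f (toHullGroup f r) = f r := by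
  change f (1 * r) = f r
  rw [one_mul]

end Hull

/-! ### Approximation by trigonometric polynomials -/

section Approximation

variable {A : Type*} [CommGroup A] [TopologicalSpace A] [IsTopologicalGroup A]

theorem isClosed_AP : IsClosed (AP A : Set (A →ᵇ ℂ)) := by
  refine isClosed_of_closure_subset fun f hf => ?_
  change TotallyBounded (translates f)
  rw [Metric.totallyBounded_iff]
  intro ε hε
  obtain ⟨g, hg, hfg⟩ := Metric.mem_closure_iff.1 hf (ε / 2) (half_pos hε)
  obtain ⟨t, ht, hcov⟩ := Metric.totallyBounded_iff.1 (hg : TotallyBounded (translates g)) (ε / 2)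
    (half_pos hε)
  refine ⟨t, ht, ?_⟩
  rintro _ ⟨a, rfl⟩
  obtain ⟨y, hy, hay⟩ := Set.mem_iUnion₂.1 (hcov ⟨a, rfl⟩)
  refine Set.mem_iUnion₂.2 ⟨y, hy, ?_⟩
  rw [Metric.mem_ball] at hay ⊢
  calc dist (translate a f) y ≤ dist (translate a f) (translate a g) + dist (translate a g) y :=
        dist_triangle _ _ _
    _ < ε / 2 + ε / 2 := add_lt_add (by rwa [dist_translate]) hay
    _ = ε := add_halves ε

/-- The translates of a character are multiples of it by elements of the unit circle. -/
theorem isAlmostPeriodic_characterBCF (χ : PontryaginDual A) :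
    IsAlmostPeriodic (characterBCF χ) := by
  have hc : Continuous fun z : Circle => (z : ℂ) • characterBCF χ :=
    continuous_subtype_val.smul continuous_const
  refine (isCompact_range hc).totallyBounded.subset ?_
  rintro _ ⟨a, rfl⟩
  refine ⟨χ a, ?_⟩
  ext x
  change (χ a : ℂ) * (χ x : ℂ) = (χ (x * a) : ℂ)
  rw [map_mul, Circle.coe_mul, mul_comm]

theorem trigPolynomials_le_AP :
    trigPolynomials A ≤ Subalgebra.toSubmodule (AP A).toSubalgebra := by
  refine Submodule.span_le.2 ?_
  rintro _ ⟨χ, rfl⟩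
  exact isAlmostPeriodic_characterBCF χ

theorem isAlmostPeriodic_iff_mem_closure {f : A →ᵇ ℂ} :
    IsAlmostPeriodic f ↔ f ∈ closure (trigPolynomials A : Set (A →ᵇ ℂ)) := by
  constructor
  · intro hf
    have := hf.compactSpace_hullGroup
    let h : A →ₜ* hullGroup f := ⟨toHullGroup f, hf.continuous_toHullGroup⟩
    have hmem := pullback_mem_closure_trigPolynomials h (hullEval f)
    convert hmem using 1
    ext r
    exact (hullEval_toHullGroup f r).symm
  · intro hf
    exact closure_minimal trigPolynomials_le_AP isClosed_AP hf

end Approximation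

/-! ### The Bohr compactification -/

section Bohr

variable (A : Type*) [CommGroup A] [TopologicalSpace A]

/-- Evaluation at a character of `A`, as a character of the Bohr compactification. -/
noncomputable def dualEval : DiscreteDual A →* PontryaginDual (BohrCompactification A) where
  toFun φ :=
    ({ toFun := fun b => b φ
       map_one' := rfl
       map_mul' := fun _ _ => rfl
       continuous_toFun := (continuous_eval_const (F := C(DiscreteDual A, Circle)) φ).comp
        (ContinuousMonoidHom.isInducing_toContinuousMap (DiscreteDual A) Circle).continuous } :
      BohrCompactification A →ₜ* Circle)
  map_one' := PontryaginDual.ext fun b => map_one b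
  map_mul' φ ψ := PontryaginDual.ext fun b => map_mul b φ ψ

variable {A}

theorem continuous_bohrHom : Continuous (bohrHom A) := by
  refine (ContinuousMonoidHom.isInducing_toContinuousMap (DiscreteDual A) Circle).continuous_iff.2 ?_
  refine ContinuousMap.continuous_of_continuous_uncurry _ ?_
  refine continuous_prod_of_discrete_right.2 fun φ => ?_
  exact map_continuous (show PontryaginDual A from φ)

theorem dense_span_dualEval :
    Dense (Submodule.span ℂ (Set.range fun φ => characterCM (dualEval A φ)) :
      Set C(BohrCompactification A, ℂ)) := by
  refine dense_span_characterCM (dualEval A) fun b b' hb => ?_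
  by_contra! h
  exact hb (PontryaginDual.ext h)

/-- Orthogonality: a nontrivial homomorphism into the circle has integral zero against an invariant
measure. -/
theorem integral_circle_eq_zero {G : Type*} [Group G] [MeasurableSpace G] [MeasurableMul G]
    (μ : Measure G) [μ.IsMulLeftInvariant] (χ : G →* Circle) {y : G} (hy : χ y ≠ 1) :
    ∫ x, (χ x : ℂ) ∂μ = 0 := by
  have h := integral_mul_left_eq_self (μ := μ) (fun x => (χ x : ℂ)) y
  simp_rw [map_mul, Circle.coe_mul] at h
  rw [integral_const_mul] at h
  by_contra h0
  exact hy (Circle.coe_injective (by simpa using (mul_eq_right₀ h0).1 h))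

theorem continuous_integral_continuousMap {X : Type*} [TopologicalSpace X] [CompactSpace X]
    [MeasurableSpace X] [BorelSpace X] (μ : Measure X) [IsFiniteMeasure μ] :
    Continuous fun g : C(X, ℂ) => ∫ x, g x ∂μ := by
  refine (LipschitzWith.of_dist_le_mul (K := (μ.real Set.univ).toNNReal) fun g g' => ?_).continuous
  rw [dist_eq_norm, dist_eq_norm, ← integral_sub (integrable_of_continuous μ g.continuous)
    (integrable_of_continuous μ g'.continuous), Real.coe_toNNReal _ measureReal_nonneg, mul_comm]
  exact norm_integral_le_of_norm_le_const (Filter.Eventually.of_forall fun x =>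
    (g - g').norm_coe_le_norm x)

theorem injective_bohrHom_iff : Function.Injective (bohrHom A) ↔
    ∀ a b : A, a ≠ b → ∃ χ : PontryaginDual A, χ a ≠ χ b := by
  constructor
  · intro h a b hab
    by_contra! hχ
    exact hab (h (PontryaginDual.ext fun φ => hχ φ))
  · intro h a b hab
    by_contra hne
    obtain ⟨χ, hχ⟩ := h a b hne
    exact hχ (DFunLike.congr_fun hab (show DiscreteDual A from χ))

/-- The Haar probability measure of the Bohr compactification and that of the closure `C` of the
image of `A` both annihilate every nontrivial character `φ` of `A`, hence they agree on all
continuous functions. As Haar measure charges every nonempty open set, `C` is everything. -/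
theorem denseRange_bohrHom : DenseRange (bohrHom A) := by
  let C : Subgroup (BohrCompactification A) := (bohrHom A).range.topologicalClosure
  have hC : IsClosed (C : Set (BohrCompactification A)) :=
    Subgroup.isClosed_topologicalClosure _
  have : CompactSpace C := isCompact_iff_compactSpace.1 hC.isCompact
  borelize (BohrCompactification A)
  let μ : Measure (BohrCompactification A) := Measure.haarMeasure ⊤
  let ν : Measure C := Measure.haarMeasure ⊤
  have hμ : IsProbabilityMeasure μ := ⟨Measure.haarMeasure_self⟩
  have hν : IsProbabilityMeasure ν := ⟨Measure.haarMeasure_self⟩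
  let incl : C(C, BohrCompactification A) := ⟨Subtype.val, continuous_subtype_val⟩
  have hchar : ∀ φ : DiscreteDual A, ∫ x, characterCM (dualEval A φ) x ∂μ =
      ∫ x, (characterCM (dualEval A φ)).comp incl x ∂ν := by
    intro φ
    by_cases hφ : φ = 1
    · subst hφ
      rw [map_one]
      change ∫ _, ((1 : Circle) : ℂ) ∂μ = ∫ _, ((1 : Circle) : ℂ) ∂ν
      simp
    · obtain ⟨a, ha⟩ : ∃ a : A, (show PontryaginDual A from φ) a ≠ 1 := by
        by_contra! h
        exact hφ (PontryaginDual.ext h)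
      have h1 := integral_circle_eq_zero μ
        (dualEval A φ : BohrCompactification A →* Circle) (y := bohrHom A a) ha
      have h2 := integral_circle_eq_zero ν
        ((dualEval A φ : BohrCompactification A →* Circle).comp C.subtype)
        (y := ⟨bohrHom A a, Subgroup.le_topologicalClosure _ ⟨a, rfl⟩⟩) ha
      exact h1.trans h2.symm
  have hspan : ∀ g ∈ Submodule.span ℂ (Set.range fun φ => characterCM (dualEval A φ)),
      ∫ x, g x ∂μ = ∫ x, g.comp incl x ∂ν := by
    intro g hg
    induction hg using Submodule.span_induction with
    | mem g hg =>
      obtain ⟨φ, rfl⟩ := hg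
      exact hchar φ
    | zero => simp
    | add g g' _ _ hg hg' =>
      have h1 := integral_add (integrable_of_continuous μ g.continuous)
        (integrable_of_continuous μ g'.continuous)
      have h2 := integral_add (integrable_of_continuous ν (g.comp incl).continuous)
        (integrable_of_continuous ν (g'.comp incl).continuous)
      rw [hg, hg'] at h1
      exact h1.trans h2.symm
    | smul c g _ hg =>
      have h1 := integral_const_mul (μ := μ) c g
      have h2 := integral_const_mul (μ := ν) c (g.comp incl)
      rw [hg] at h1
      exact h1.trans h2.symm
  have hall : ∀ g : C(BohrCompactification A, ℂ), ∫ x, g x ∂μ = ∫ x, g.comp incl x ∂ν := by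
    refine congrFun (Continuous.ext_on dense_span_dualEval (continuous_integral_continuousMap μ)
      ((continuous_integral_continuousMap ν).comp (ContinuousMap.continuous_precomp incl)) hspan)
  intro b
  by_contra hb
  obtain ⟨g, hg0, hg1, hg⟩ := exists_continuous_zero_one_of_isClosed hC
    (isClosed_singleton (x := b)) (Set.disjoint_singleton_right.2 hb)
  have h := hall ⟨fun x => (g x : ℂ), Complex.continuous_ofReal.comp g.continuous⟩
  have hν0 : ∫ x : C, ((g x : ℝ) : ℂ) ∂ν = 0 := by
    refine integral_eq_zero_of_ae (Filter.Eventually.of_forall fun x => ?_)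
    simp [hg0 x.2]
  have hpos : 0 < ∫ x, g x ∂μ := by
    refine g.continuous.integral_pos_of_hasCompactSupport_nonneg_nonzero
      (HasCompactSupport.of_compactSpace _) (fun x => (hg x).1) (x := b) ?_
    simp [hg1 rfl]
  have h' : ∫ x, ((g x : ℝ) : ℂ) ∂μ = 0 := h.trans hν0
  rw [integral_complex_ofReal] at h'
  exact hpos.ne' (by exact_mod_cast h')

/-- The homomorphism from `A` into its Bohr compactification, as a bundled continuous map. -/
noncomputable def bohrCM (A : Type*) [CommGroup A] [TopologicalSpace A] :
    A →ₜ* BohrCompactification A := ⟨bohrHom A, continuous_bohrHom⟩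

variable [IsTopologicalGroup A]

/-- Composition with the homomorphism from `A` into its Bohr compactification, as a map into the
almost periodic functions. -/
noncomputable def bohrPullback : C(BohrCompactification A, ℂ) →⋆ₐ[ℂ] AP A :=
  (pullback (bohrCM A : C(A, BohrCompactification A))).codRestrict (AP A) fun g =>
    isAlmostPeriodic_iff_mem_closure.2 (pullback_mem_closure_trigPolynomials (bohrCM A) g)

theorem bohrPullback_apply (g : C(BohrCompactification A, ℂ)) (a : A) :
    (bohrPullback g : A →ᵇ ℂ) a = g (bohrHom A a) := rfl

theorem isometry_bohrPullback : Isometry (bohrPullback (A := A)) := by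
  refine AddMonoidHomClass.isometry_of_norm _ fun g => le_antisymm ?_ ?_
  · exact (BoundedContinuousFunction.norm_le (norm_nonneg g)).2 fun a => g.norm_coe_le_norm _
  · refine (ContinuousMap.norm_le _ (norm_nonneg _)).2 fun b => ?_
    refine denseRange_bohrHom.induction_on b
      (isClosed_le g.continuous.norm continuous_const) fun a => ?_
    exact (bohrPullback g : A →ᵇ ℂ).norm_coe_le_norm a

/-- The image is complete, hence closed, and contains the characters. -/
theorem surjective_bohrPullback : Function.Surjective (bohrPullback (A := A)) := by
  intro f
  let Ψ : C(BohrCompactification A, ℂ) →⋆ₐ[ℂ] (A →ᵇ ℂ) :=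
    pullback (bohrCM A : C(A, BohrCompactification A))
  have hiso : Isometry Ψ := isometry_subtype_coe.comp isometry_bohrPullback
  have hcl : IsClosed (Set.range Ψ) := hiso.isClosedEmbedding.isClosed_range
  have hle : trigPolynomials A ≤ LinearMap.range Ψ.toAlgHom.toLinearMap := by
    refine Submodule.span_le.2 ?_
    rintro _ ⟨φ, rfl⟩
    exact ⟨characterCM (dualEval A φ), rfl⟩
  obtain ⟨g, hg⟩ : (f : A →ᵇ ℂ) ∈ Set.range Ψ :=
    closure_minimal hle hcl (isAlmostPeriodic_iff_mem_closure.1 f.2)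
  exact ⟨g, Subtype.ext hg⟩

end Bohr

end AlmostPeriodic

theorem mainTheorem9 (A : Type*) [CommGroup A] [TopologicalSpace A] [IsTopologicalGroup A] :
    -- almost periodic functions are the uniform limits of finite linear combinations of characters
    (∀ f : A →ᵇ ℂ, IsAlmostPeriodic f ↔
      ∀ ε : ℝ, 0 < ε → ∃ (n : ℕ) (c : Fin n → ℂ) (χ : Fin n → PontryaginDual A),
        ∀ x : A, ‖f x - ∑ i, c i * (χ i x : ℂ)‖ < ε) ∧
    -- realisation on the closure of the group of translations of the hull
    (∀ f : A →ᵇ ℂ, IsAlmostPeriodic f →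
      IsCompact (hull f) ∧
      CompactSpace (hull f ≃ᵢ hull f) ∧
      IsTopologicalGroup (hull f ≃ᵢ hull f) ∧
      CompactSpace (hullGroup f) ∧
      (∀ R S : hullGroup f, R * S = S * R) ∧
      Continuous (toHullGroup f) ∧
      DenseRange (toHullGroup f) ∧
      ∃ Λ : C(hullGroup f, ℂ),
        (∀ R : hullGroup f,
          Λ R = ((R : hull f ≃ᵢ hull f) ⟨f, self_mem_hull f⟩ : A →ᵇ ℂ) 1) ∧
        ∀ r : A, f r = Λ (toHullGroup f r)) ∧
    -- the Bohr compactification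
    (CompactSpace (BohrCompactification A) ∧
      T2Space (BohrCompactification A) ∧
      IsTopologicalGroup (BohrCompactification A) ∧
      Continuous (bohrHom A) ∧
      DenseRange (bohrHom A) ∧
      (Function.Injective (bohrHom A) ↔
        ∀ a b : A, a ≠ b → ∃ χ : PontryaginDual A, χ a ≠ χ b) ∧
      ∃ Φ : C(BohrCompactification A, ℂ) ≃⋆ₐ[ℂ] AP A,
        Isometry Φ ∧
        ∀ (g : C(BohrCompactification A, ℂ)) (a : A), (Φ g : A →ᵇ ℂ) a = g (bohrHom A a)) := by
  refine ⟨fun f => isAlmostPeriodic_iff_mem_closure.trans mem_closure_trigPolynomials_iff,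
    fun f hf => ?_, inferInstance, inferInstance, inferInstance, continuous_bohrHom,
    denseRange_bohrHom, injective_bohrHom_iff, ?_⟩
  · have : CompactSpace (hull f) := isCompact_iff_compactSpace.1 hf.isCompact_hull
    exact ⟨hf.isCompact_hull, inferInstance, inferInstance, hf.compactSpace_hullGroup,
      hullGroup_mul_comm f, hf.continuous_toHullGroup, denseRange_toHullGroup f, hullEval f,
      fun _ => rfl, fun r => (hullEval_toHullGroup f r).symm⟩
  · exact ⟨StarAlgEquiv.ofBijective bohrPullback
      ⟨isometry_bohrPullback.injective, surjective_bohrPullback⟩, isometry_bohrPullback,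
      bohrPullback_apply⟩
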